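/- **Setting.** All Hilbert spaces are finite dimensional. $\mathcal L(H,K)$ is the real vector space of Hermitian linear maps $B(H)\to B(K)$; for $\phi\in\mathcal L(H,H)$ put $s(\phi)=\sum_{i,j}\langle i,\phi(|i\rangle\langle j|)\,j\rangle$ (over an orthonormal basis of $H$), and let $\langle\phi,\psi\rangle=s(\phi\circ\psi)$ be the duality between $\mathcal L(H,K)$ and $\mathcal L(K,H)$. An *admissible family of positive cones* $\mathcal P$ consists of proper (closed, convex, pointed, generating) cones $\mathcal P(H,K)\subseteq\mathcal L(H,K)$ for all $H,K$ such that $EB\subseteq\mathcal P\subseteq Pos$, $\mathcal P\circ\mathcal P\subseteq\mathcal P$ and $CP\circ\mathcal P\circ CP\subseteq\mathcal P$, where $Pos$, $CP$, $EB$ are the cones of positive, completely positive and entanglement breaking maps (the maps $a\mapsto\sum_i\mathrm{Tr}(F_ia)\rho_i$ with $F_i,\rho_i\ge 0$). The dual cones are $\mathcal P^*(K,H)=\{\psi\in\mathcal L(K,H):\langle\phi,\psi\rangle\ge 0\ \forall\phi\in\mathcal P(H,K)\}$. A C*-algebra is a nonzero algebra $\mathcal A=\bigoplus_k B(H_k)\subseteq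 B(H)$, $H=\bigoplus_kH_k$, with trace preserving conditional expectation $E_{\mathcal A}:B(H)\to\mathcal A$. For $\mathcal A\subseteq B(H)$, $\mathcal B\subseteq B(K)$, the Hermitian maps $\phi:\mathcal A\to\mathcal B$ form the space $\mathcal L(\mathcal A,\mathcal B)\subseteq \mathcal L(H,K)$, $\phi$ being identified with $E_{\mathcal B}\circ\phi\circ E_{\mathcal A}$; $\mathcal P(\mathcal A,\mathcal B)=\mathcal P(H,K)\cap\mathcal L(\mathcal A,\mathcal B)$, $\mathcal P^*(\mathcal B,\mathcal A)=\mathcal P^*(K,H)\cap\mathcal L(\mathcal B,\mathcal A)$, and $\mathcal C(\mathcal A,\mathcal B)$ is the set of trace preserving elements of $\mathcal P(\mathcal A,\mathcal B)$. On $\mathcal L(\mathcal A,\mathcal B)$ let $$\|\phi\|_\diamond=\inf\{\lambda>0:\ \lambda\alpha\pm\phi\in\mathcal P(\mathcal A,\mathcal B)\text{ for some }\alpha\in\mathcal C(\mathcal A,\mathcal B)\},$$ and let $\|\cdot\|^\diamond$ on $\mathcal L(\mathcal A,\mathcal B)$ be the dual norm of $\|\cdot\|_\diamond$ on $\mathcal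 L(\mathcal B,\mathcal A)$: $\|\phi\|^\diamond=\sup\{\langle\phi,\xi\rangle:\ \xi\in\mathcal L(\mathcal B,\mathcal A),\ \|\xi\|_\diamond\le1\}$. For $\Phi\in\mathcal C(\mathcal A,\mathcal B)$, $\Psi\in\mathcal C(\mathcal A',\mathcal B)$ and $\epsilon\ge0$, $\Psi$ is *$(\epsilon,\mathcal D)$-pre-processing deficient* with respect to $\Phi$, written $\Psi\succeq^{\epsilon,\mathcal D}\Phi$, if for all $\Gamma\in\mathcal P^*(\mathcal B,\mathcal D)$ and $\beta\in\mathcal C(\mathcal D,\mathcal A)$ there is $\beta'\in\mathcal C(\mathcal D,\mathcal A')$ with $\langle\Phi\circ\beta,\Gamma\rangle\le\langle\Psi\circ\beta',\Gamma\rangle+\epsilon\|\Gamma\|^\diamond$; and $\Psi\succeq^{\epsilon}\Phi$ if this holds for every C*-algebra $\mathcal D$. **Theorem (Pre-processing).** Let $\mathcal P$ be an admissible family of positive cones, $\Phi\in\mathcal C(\mathcal A,\mathcal B)$, $\Psi\in\mathcal C(\mathcal A',\mathcal B)$, $\epsilon\ge0$, and let $\mathcal D$ be any C*-algebra. The following are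 equivalent. 1. $\Psi\succeq^{\epsilon,\mathcal D}\Phi$. 2. For any $\Gamma\in\mathcal P^*(\mathcal B,\mathcal D)$, $\ \|\Gamma\circ\Phi\|^\diamond\le\|\Gamma\circ\Psi\|^\diamond+\epsilon\|\Gamma\|^\diamond$. 3. For any $\Gamma\in\mathcal L(\mathcal B,\mathcal D)$ and all $\beta\in\mathcal C(\mathcal D,\mathcal A)$ there is $\beta'\in\mathcal C(\mathcal D,\mathcal A')$ with $\langle\Phi\circ\beta,\Gamma\rangle\le\langle\Psi\circ\beta',\Gamma\rangle+2\epsilon\|\Gamma\|^\diamond$. 4. For any $\beta\in\mathcal C(\mathcal D,\mathcal A)$ there is $\beta'\in\mathcal C(\mathcal D,\mathcal A')$ with $\|\Phi\circ\beta-\Psi\circ\beta'\|_\diamond\le2\epsilon$. Moreover, if $id_{\mathcal A}\in\mathcal P(\mathcal A,\mathcal A)$, then $\Psi\succeq^{\epsilon}\Phi$ if and only if $\Psi\succeq^{\epsilon,\mathcal A}\Phi$. -/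

import Mathlib

open scoped ComplexOrder

namespace ChannelComparison

/-- `B(H)` for the Hilbert space `H = ℂⁿ` with its standard orthonormal basis. -/
abbrev Mat (n : ℕ) : Type := Matrix (Fin n) (Fin n) ℂ

/-- Linear maps `B(H) → B(K)`, with `H = ℂⁿ` and `K = ℂᵐ`. -/
abbrev SMap (n m : ℕ) : Type := Mat n →ₗ[ℂ] Mat m

/-- `L(H, K)`: the real linear space of Hermitian linear maps `B(H) → B(K)`
(equivalently, of real linear maps between the spaces of Hermitian operators). -/
def HermMaps (n m : ℕ) : Submodule ℝ (SMap n m) where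
  carrier := {φ | ∀ x : Mat n, x.IsHermitian → (φ x).IsHermitian}
  add_mem' := fun {φ ψ} hφ hψ x hx => by
    simpa using (hφ x hx).add (hψ x hx)
  zero_mem' := fun x _ => by simp
  smul_mem' := fun c φ hφ x hx => by
    have h := hφ x hx
    simp only [Matrix.IsHermitian, LinearMap.smul_apply, Matrix.conjTranspose_smul,
      star_trivial] at h ⊢
    rw [h]

/-- The functional `s(φ) = ∑ i j, ⟨i, φ(|i⟩⟨j|) j⟩`; on Hermitian maps its values are real. -/
noncomputable def sFun {n : ℕ} (φ : SMap n n) : ℝ :=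
  (∑ i, ∑ j, φ (Matrix.single i j 1) i j).re

/-- The duality `⟨φ, ψ⟩ = s(φ ∘ ψ)` of `L(H, K)` and `L(K, H)`. -/
noncomputable def pairing {n m : ℕ} (φ : SMap n m) (ψ : SMap m n) : ℝ :=
  sFun (φ ∘ₗ ψ)

/-- Positive maps. -/
def Pos (n m : ℕ) : Set (SMap n m) :=
  {φ | φ ∈ HermMaps n m ∧ ∀ x : Mat n, x.PosSemidef → (φ x).PosSemidef}

/-- `φ ⊗ id` on `B(ℂⁿ ⊗ ℂᵏ)`. -/
def ampliate {n m : ℕ} (k : ℕ) (φ : SMap n m)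
    (X : Matrix (Fin n × Fin k) (Fin n × Fin k) ℂ) :
    Matrix (Fin m × Fin k) (Fin m × Fin k) ℂ :=
  Matrix.of fun p q => φ (Matrix.of fun i j => X (i, p.2) (j, q.2)) p.1 q.1

/-- Completely positive maps. -/
def CP (n m : ℕ) : Set (SMap n m) :=
  {φ | φ ∈ HermMaps n m ∧ ∀ (k : ℕ) (X : Matrix (Fin n × Fin k) (Fin n × Fin k) ℂ),
    X.PosSemidef → (ampliate k φ X).PosSemidef}

/-- Entanglement breaking (superpositive) maps `a ↦ ∑ i, Tr(Fᵢ a) ρᵢ` with `Fᵢ, ρᵢ ≥ 0`. -/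
def EB (n m : ℕ) : Set (SMap n m) :=
  {φ | ∃ (k : ℕ) (F : Fin k → Mat n) (ρ : Fin k → Mat m),
    (∀ i, (F i).PosSemidef) ∧ (∀ i, (ρ i).PosSemidef) ∧
      ∀ a, φ a = ∑ i, (F i * a).trace • ρ i}

/-- A proper cone in the finite-dimensional real vector space `L(H, K)`: a closed convex cone that
is pointed and generating. -/
structure IsProperCone {n m : ℕ} (Q : Set (SMap n m)) : Prop where
  subset_herm : ∀ φ ∈ Q, φ ∈ HermMaps n m
  zero_mem : (0 : SMap n m) ∈ Q
  add_mem : ∀ φ ∈ Q, ∀ ψ ∈ Q, φ + ψ ∈ Q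
  smul_mem : ∀ (c : ℝ), 0 ≤ c → ∀ φ ∈ Q, c • φ ∈ Q
  closed : ∀ (u : ℕ → SMap n m) (φ : SMap n m), (∀ k, u k ∈ Q) →
    (∀ x, Filter.Tendsto (fun k => u k x) Filter.atTop (nhds (φ x))) → φ ∈ Q
  pointed : ∀ φ ∈ Q, -φ ∈ Q → φ = 0
  generating : ∀ φ ∈ HermMaps n m, ∃ φ₁ ∈ Q, ∃ φ₂ ∈ Q, φ = φ₁ - φ₂

/-- A family of subsets `𝒫(H, K)`, one for each pair of finite-dimensional Hilbert spaces. -/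
abbrev ConeFamily : Type := ∀ n m : ℕ, Set (SMap n m)

/-- Admissible families of positive cones. -/
structure Admissible (P : ConeFamily) : Prop where
  proper : ∀ n m, IsProperCone (P n m)
  eb_subset : ∀ n m, EB n m ⊆ P n m
  subset_pos : ∀ n m, P n m ⊆ Pos n m
  comp_mem : ∀ (n m l : ℕ), ∀ φ ∈ P n m, ∀ ψ ∈ P m l, ψ ∘ₗ φ ∈ P n l
  cp_comp_mem : ∀ (n n' m m' : ℕ), ∀ α ∈ CP n n', ∀ φ ∈ P n' m', ∀ β ∈ CP m' m,
    β ∘ₗ φ ∘ₗ α ∈ P n m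

/-- A (nonzero) finite-dimensional C*-algebra `𝒜 = ⨁ₖ B(Hₖ) ⊆ B(H)`, `H = ⨁ₖ Hₖ = ℂ^dim`, where
`Hₖ` is spanned by the basis vectors with label `block i = k`. -/
structure Alg where
  dim : ℕ
  dim_pos : 0 < dim
  block : Fin dim → ℕ

namespace Alg

/-- The algebra itself: the block diagonal matrices. -/
def toStarSubalgebra (A : Alg) : StarSubalgebra ℂ (Mat A.dim) where
  carrier := {a | ∀ i j, A.block i ≠ A.block j → a i j = 0}
  mul_mem' := fun {a b} ha hb i j hij => by
    rw [Matrix.mul_apply]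
    refine Finset.sum_eq_zero fun k _ => ?_
    by_cases h : A.block i = A.block k
    · rw [hb k j (fun h' => hij (h.trans h')), mul_zero]
    · rw [ha i k h, zero_mul]
  add_mem' := fun {a b} ha hb i j hij => by
    rw [Matrix.add_apply, ha i j hij, hb i j hij, add_zero]
  algebraMap_mem' := fun c i j hij => by
    have h : i ≠ j := fun h => hij (congrArg A.block h)
    simp [Matrix.algebraMap_matrix_apply, h]
  star_mem' := fun {a} ha i j hij => by
    rw [Matrix.star_apply, ha j i (Ne.symm hij), star_zero]

/-- The trace preserving conditional expectation `E_𝒜 : B(H) → 𝒜`. -/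
def condExp (A : Alg) : SMap A.dim A.dim where
  toFun a := Matrix.of fun i j => if A.block i = A.block j then a i j else 0
  map_add' a b := by
    ext i j
    by_cases h : A.block i = A.block j <;> simp [h]
  map_smul' c a := by
    ext i j
    by_cases h : A.block i = A.block j <;> simp [h]

theorem condExp_mem (A : Alg) (a : Mat A.dim) : A.condExp a ∈ A.toStarSubalgebra :=
  fun _ _ hij => if_neg hij

theorem trace_condExp_mul (A : Alg) (a b : Mat A.dim) (hb : b ∈ A.toStarSubalgebra) :
    (A.condExp a * b).trace = (a * b).trace := by
  simp only [Matrix.trace, Matrix.diag, Matrix.mul_apply]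
  refine Finset.sum_congr rfl fun i _ => Finset.sum_congr rfl fun j _ => ?_
  by_cases h : A.block i = A.block j
  · simp [condExp, h]
  · rw [hb j i (Ne.symm h), mul_zero, mul_zero]

end Alg

/-- `L(𝒜, ℬ)` as a subspace of `L(H, K)`: a map `φ : 𝒜 → ℬ` is identified with
`E_ℬ ∘ φ ∘ E_𝒜`, so the members are the Hermitian maps with `E_ℬ ∘ φ ∘ E_𝒜 = φ`.
In particular the identity map of `𝒜` becomes `E_𝒜`. -/
def algMaps (A B : Alg) : Set (SMap A.dim B.dim) :=
  {φ | φ ∈ HermMaps A.dim B.dim ∧ B.condExp ∘ₗ φ ∘ₗ A.condExp = φ}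

/-- `𝒫(𝒜, ℬ) = 𝒫(H, K) ∩ L(𝒜, ℬ)`. -/
def algCone (P : ConeFamily) (A B : Alg) : Set (SMap A.dim B.dim) :=
  P A.dim B.dim ∩ algMaps A B

/-- The dual family: `𝒫*(K, H)` is the dual cone of `𝒫(H, K)`. -/
def dualFamily (P : ConeFamily) : ConeFamily := fun m n =>
  {ψ | ψ ∈ HermMaps m n ∧ ∀ φ ∈ P n m, 0 ≤ pairing φ ψ}

/-- `𝒫*(ℬ, 𝒜) = 𝒫*(K, H) ∩ L(ℬ, 𝒜)`. -/
def algDualCone (P : ConeFamily) (B A : Alg) : Set (SMap B.dim A.dim) :=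
  dualFamily P B.dim A.dim ∩ algMaps B A

/-- `𝒞(𝒜, ℬ)`: the `𝒫`-channels, that is, the trace preserving elements of `𝒫(𝒜, ℬ)`. -/
def channels (P : ConeFamily) (A B : Alg) : Set (SMap A.dim B.dim) :=
  {φ | φ ∈ algCone P A B ∧ ∀ a, (φ a).trace = a.trace}

/-- The norm defined by a base section `S` of the cone `Q`: the gauge of
`{x | ∃ b ∈ S, -b ≤ x ≤ b}`. -/
noncomputable def sectionNorm {V : Type*} [AddCommGroup V] [Module ℝ V] (Q S : Set V) (x : V) : ℝ :=
  sInf {t : ℝ | 0 < t ∧ ∃ b ∈ S, t • b - x ∈ Q ∧ t • b + x ∈ Q}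

/-- `‖φ‖_⋄` on `L(𝒜, ℬ)`: the norm of the base section `𝒞(𝒜, ℬ)` of `𝒫(𝒜, ℬ)`. -/
noncomputable def diamondNorm (P : ConeFamily) (A B : Alg) (φ : SMap A.dim B.dim) : ℝ :=
  sectionNorm (algCone P A B) (channels P A B) φ

/-- `‖φ‖^⋄` on `L(𝒜, ℬ)`: the dual norm of `‖·‖_⋄` on `L(ℬ, 𝒜)`. -/
noncomputable def dualDiamondNorm (P : ConeFamily) (A B : Alg) (φ : SMap A.dim B.dim) : ℝ :=
  sSup {r : ℝ | ∃ ξ ∈ algMaps B A, diamondNorm P B A ξ ≤ 1 ∧ r = pairing φ ξ}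

/-- `(ε, 𝒟)`-pre-processing deficiency of `Ψ : 𝒜' → ℬ` with respect to `Φ : 𝒜 → ℬ`. -/
def PreDeficientFor (P : ConeFamily) {A A' B : Alg} (ε : ℝ) (D : Alg)
    (Ψ : SMap A'.dim B.dim) (Φ : SMap A.dim B.dim) : Prop :=
  ∀ Γ ∈ algDualCone P B D, ∀ β ∈ channels P D A, ∃ β' ∈ channels P D A',
    pairing (Φ ∘ₗ β) Γ ≤ pairing (Ψ ∘ₗ β') Γ + ε * dualDiamondNorm P B D Γ

/-- `ε`-pre-processing deficiency: `(ε, 𝒟)`-deficiency for all `𝒟`. -/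
def PreDeficient (P : ConeFamily) {A A' B : Alg} (ε : ℝ)
    (Ψ : SMap A'.dim B.dim) (Φ : SMap A.dim B.dim) : Prop :=
  ∀ D : Alg, PreDeficientFor (A := A) (A' := A') (B := B) P ε D Ψ Φ

end ChannelComparison

/-! Everything rests on two dual descriptions. First, for `Γ` in the dual cone, `‖Γ‖^⋄` is attained
on channels (`dualDiamondNorm_eq_pairing_channel`): a map of norm at most 1 lies, up to slack, below
a channel, and pairing with `Γ` is monotone. Since `𝒫 ∘ 𝒫 ⊆ 𝒫`, the same applies to `Γ ∘ Φ`, so `‖Γ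
∘ Φ‖^⋄` is the maximum of `⟨Φ ∘ β, Γ⟩` over `β`, and 1 ⇔ 2 is immediate.

Second, statements quantified over `Γ` become statements about maps by Hahn-Banach separation. For 1
⇒ 4, separate `Φ ∘ β` from `Ψ ∘ 𝒞(𝒟, 𝒜') + ε 𝒞(𝒟, ℬ) - 𝒫(𝒟, ℬ)`; the cone summand forces the
separating `Γ` into the dual cone, where deficiency contradicts it. Hence `Φ ∘ β - Ψ ∘ β' = ε μ - p`
with `μ` a channel and `p` in the cone (`exists_eq_sub_of_preDeficientFor`). Comparing traces, `ε μ
+ p` is `2ε` times a channel, and it dominates both signs of the difference. Conversely, for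
channels `φ, ψ` a two-sided bound by `2ε α` costs only `ε` against the dual cone
(`pairing_sub_channels_le`). For 3 ⇔ 4, `Γ` ranges over the whole space, and the cone is replaced by
the norm ball of radius `2ε`.

The last claim is 4 at `β = id`: the resulting `β'`, precomposed with any channel, serves every `𝒟`.
-/

namespace ChannelComparison

/-! ### Order bound for Hermitian matrices -/

section MatrixBounds
open scoped MatrixOrder Matrix.Norms.L2Operator

theorem exists_smul_one_sub_posSemidef {n : ℕ} {a : Mat n} (ha : a.IsHermitian) :
    ∃ t : ℝ, 0 < t ∧ (t • (1 : Mat n) - a).PosSemidef := by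
  -- The extra 1 keeps the constant strictly positive when `a = 0`.
  refine ⟨‖a‖ + 1, by positivity, ?_⟩
  have h : (‖a‖ • (1 : Mat n) - a).PosSemidef := by
    rw [← Matrix.le_iff, ← Algebra.algebraMap_eq_smul_one]
    exact IsSelfAdjoint.le_algebraMap_norm_self (a := a) ha
  have h2 := h.add (Matrix.PosSemidef.one (n := Fin n) (R := ℂ))
  convert h2 using 1
  rw [add_smul, one_smul]; abel

end MatrixBounds

/-! ### The trace pairing of superoperators -/

theorem sFun_eq_trace {n : ℕ} (φ : SMap n n) : sFun φ = (LinearMap.trace ℂ (Mat n) φ).re := by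
  rw [sFun, LinearMap.trace_eq_matrix_trace ℂ (Matrix.stdBasis ℂ (Fin n) (Fin n))]
  congr 1
  rw [Matrix.trace, Fintype.sum_prod_type]
  refine Finset.sum_congr rfl fun i _ => Finset.sum_congr rfl fun j _ => ?_
  rw [Matrix.diag, LinearMap.toMatrix_apply, Matrix.stdBasis_eq_single]
  simp [Matrix.stdBasis, Pi.basis_repr]

theorem pairing_comm {n m : ℕ} (φ : SMap n m) (ψ : SMap m n) : pairing φ ψ = pairing ψ φ := by
  rw [pairing, pairing, sFun_eq_trace, sFun_eq_trace, LinearMap.trace_comp_comm']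

theorem pairing_comp {n m l : ℕ} (φ : SMap m l) (χ : SMap n m) (ψ : SMap l n) :
    pairing (φ ∘ₗ χ) ψ = pairing φ (χ ∘ₗ ψ) := rfl

theorem pairing_comp_left {n m l : ℕ} (φ : SMap m l) (χ : SMap n m) (ψ : SMap l n) :
    pairing (φ ∘ₗ χ) ψ = pairing χ (ψ ∘ₗ φ) := by
  rw [pairing_comm, pairing_comm χ]; rfl

/-- The pairing as a real linear functional of its first argument. -/
noncomputable def pairingLeft {n m : ℕ} (ψ : SMap m n) : SMap n m →ₗ[ℝ] ℝ where
  toFun φ := pairing φ ψ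
  map_add' φ χ := by simp [pairing, sFun, Finset.sum_add_distrib]
  map_smul' c φ := by simp [pairing, sFun, Finset.mul_sum]

@[simp] theorem pairingLeft_apply {n m : ℕ} (ψ : SMap m n) (φ : SMap n m) :
    pairingLeft ψ φ = pairing φ ψ := rfl

theorem pairing_add {n m : ℕ} (φ χ : SMap n m) (ψ : SMap m n) :
    pairing (φ + χ) ψ = pairing φ ψ + pairing χ ψ := (pairingLeft ψ).map_add φ χ

theorem pairing_sub {n m : ℕ} (φ χ : SMap n m) (ψ : SMap m n) :
    pairing (φ - χ) ψ = pairing φ ψ - pairing χ ψ := (pairingLeft ψ).map_sub φ χ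

theorem pairing_smul {n m : ℕ} (c : ℝ) (φ : SMap n m) (ψ : SMap m n) :
    pairing (c • φ) ψ = c * pairing φ ψ := (pairingLeft ψ).map_smul c φ

theorem pairing_smul_right {n m : ℕ} (c : ℝ) (φ : SMap n m) (ψ : SMap m n) :
    pairing φ (c • ψ) = c * pairing φ ψ := by
  rw [pairing_comm, pairing_smul, pairing_comm]

theorem pairing_add_right {n m : ℕ} (φ : SMap n m) (ψ χ : SMap m n) :
    pairing φ (ψ + χ) = pairing φ ψ + pairing φ χ := by
  rw [pairing_comm, pairing_add, pairing_comm, pairing_comm χ]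

/-- The elementary map `a ↦ aᵢⱼ |k⟩⟨l|`. -/
def elemMap {n m : ℕ} (i j : Fin n) (k l : Fin m) : SMap n m where
  toFun a := a i j • Matrix.single k l 1
  map_add' a b := by simp [add_smul]
  map_smul' c a := by simp [mul_smul]

theorem eq_sum_elemMap {n m : ℕ} (ξ : SMap n m) :
    ξ = ∑ k, ∑ l, ∑ i, ∑ j, ξ (Matrix.single i j 1) k l • elemMap i j k l := by
  ext a k' l'
  conv_lhs => rw [Matrix.matrix_eq_sum_single a]
  have h : ∀ i j, Matrix.single i j (a i j) = a i j • Matrix.single i j (1 : ℂ) := fun i j => by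
    simp
  simp [elemMap, h, -Matrix.smul_single, Matrix.single_apply, Matrix.sum_apply, ite_and,
    LinearMap.sum_apply, mul_comm]

/-- A real functional is the real part of a complex linear one, whose values on the elementary maps
are the matrix entries of the representing `ψ`. This turns Hahn-Banach functionals into maps. -/
theorem exists_pairing_eq {n m : ℕ} (f : SMap n m →ₗ[ℝ] ℝ) :
    ∃ ψ : SMap m n, ∀ ξ, f ξ = pairing ξ ψ := by
  let F : Module.Dual ℂ (SMap n m) := Module.Dual.extendRCLike (𝕜 := ℂ) f
  have hF : ∀ ξ, (F ξ).re = f ξ := fun ξ => by simp [F, Module.Dual.extendRCLike_apply]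
  let G : SMap m n :=
    { toFun := fun y => ∑ i, ∑ j, (∑ k, ∑ l, y k l * F (elemMap i j k l)) • Matrix.single i j 1
      map_add' := fun y z => by simp [add_mul, Finset.sum_add_distrib, add_smul]
      map_smul' := fun c y => by
        simp only [Matrix.smul_apply, smul_eq_mul, mul_assoc, ← Finset.mul_sum, mul_smul,
          ← Finset.smul_sum, RingHom.id_apply] }
  have hG : ∀ k l, G (Matrix.single k l 1) =
      ∑ i, ∑ j, F (elemMap i j k l) • Matrix.single i j 1 := by
    intro k l
    simp only [G, LinearMap.coe_mk, AddHom.coe_mk]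
    refine Finset.sum_congr rfl fun i _ => Finset.sum_congr rfl fun j _ => ?_
    simp [Matrix.single_apply, ite_and]
  refine ⟨G, fun ξ => ?_⟩
  rw [← hF, pairing, sFun]
  congr 1
  conv_lhs => rw [eq_sum_elemMap ξ]
  simp only [map_sum, map_smul, LinearMap.comp_apply, hG, Matrix.sum_apply, Matrix.smul_apply,
    smul_eq_mul]
  refine Finset.sum_congr rfl fun i _ => Finset.sum_congr rfl fun j _ =>
    Finset.sum_congr rfl fun k _ => Finset.sum_congr rfl fun l _ => mul_comm _ _

open Matrix in
/-- The adjoint map `a ↦ φ(a*)*`. -/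
def conjMap {n m : ℕ} (φ : SMap n m) : SMap n m where
  toFun a := (φ aᴴ)ᴴ
  map_add' a b := by simp
  map_smul' c a := by simp

theorem conjMap_eq_self {n m : ℕ} {φ : SMap n m} (hφ : φ ∈ HermMaps n m) : conjMap φ = φ := by
  apply LinearMap.ext
  intro a
  have key : ∀ x : Mat n, x.IsHermitian → conjMap φ x = φ x := fun x hx => by
    have := hφ x hx
    simp only [conjMap, LinearMap.coe_mk, AddHom.coe_mk]
    rw [hx.eq, this.eq]
  have h1 := key _ (realPart a).2
  have h2 := key _ (imaginaryPart a).2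
  rw [← realPart_add_I_smul_imaginaryPart a, map_add, map_add, map_smul, map_smul, h1, h2]

theorem conjMap_comp {n m l : ℕ} (φ : SMap m l) (ψ : SMap n m) :
    conjMap (φ ∘ₗ ψ) = conjMap φ ∘ₗ conjMap ψ := by
  ext; simp [conjMap]

theorem sFun_conjMap {n : ℕ} (φ : SMap n n) : sFun (conjMap φ) = sFun φ := by
  simp only [sFun, Complex.re_sum, conjMap, LinearMap.coe_mk, AddHom.coe_mk,
    Matrix.conjTranspose_single, star_one, Matrix.conjTranspose_apply]
  rw [Finset.sum_comm]
  simp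

theorem add_conjMap_mem_hermMaps {n m : ℕ} (φ : SMap n m) : φ + conjMap φ ∈ HermMaps n m := by
  intro x hx
  simp only [Matrix.IsHermitian, conjMap, LinearMap.add_apply, LinearMap.coe_mk, AddHom.coe_mk,
    Matrix.conjTranspose_add, Matrix.conjTranspose_conjTranspose]
  rw [hx.eq, add_comm]

/-! ### Conditional expectations onto block algebras -/

namespace Alg

theorem condExp_idem (A : Alg) : A.condExp ∘ₗ A.condExp = A.condExp := by
  refine LinearMap.ext fun a => Matrix.ext fun i j => ?_
  by_cases h : A.block i = A.block j <;> simp [condExp, h]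

theorem condExp_one (A : Alg) : A.condExp 1 = 1 := by
  ext i j
  by_cases h : i = j
  · subst h; simp [condExp]
  · simp [condExp, Matrix.one_apply, h]

theorem trace_condExp (A : Alg) (a : Mat A.dim) : (A.condExp a).trace = a.trace := by
  simp [condExp, Matrix.trace]

theorem condExp_mem_hermMaps (A : Alg) : A.condExp ∈ HermMaps A.dim A.dim := by
  intro x hx
  ext i j
  have := congrFun (congrFun hx.eq i) j
  by_cases h : A.block i = A.block j
  · simpa [condExp, h] using this
  · simp [condExp, h, Ne.symm h]

/-- The conditional expectation is a pinching: a sum of conjugations by the block projections, here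
tensored with the identity. -/
theorem condExp_mem_cp (A : Alg) : A.condExp ∈ CP A.dim A.dim := by
  refine ⟨A.condExp_mem_hermMaps, fun k X hX => ?_⟩
  let D : ℕ → Matrix (Fin A.dim × Fin k) (Fin A.dim × Fin k) ℂ := fun b =>
    Matrix.diagonal fun p => if A.block p.1 = b then 1 else 0
  have h : ampliate k A.condExp X =
      ∑ b ∈ Finset.univ.image A.block, D b * X * (D b).conjTranspose := by
    ext p q
    rw [Matrix.sum_apply]
    simp only [D, Matrix.diagonal_conjTranspose, Matrix.mul_diagonal, Matrix.diagonal_mul,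
      ampliate, condExp, Matrix.of_apply, LinearMap.coe_mk, AddHom.coe_mk]
    rw [Finset.sum_eq_single (A.block p.1)]
    · by_cases hpq : A.block p.1 = A.block q.1
      · simp [hpq]
      · simp [hpq, Ne.symm hpq]
    · intro b _ hb
      simp [Ne.symm hb]
    · intro hb
      simp at hb
  rw [h]
  exact Matrix.posSemidef_sum _ fun b _ => hX.mul_mul_conjTranspose_same (D b)

end Alg

theorem hermMaps_comp {n m l : ℕ} {φ : SMap m l} {ψ : SMap n m} (hφ : φ ∈ HermMaps m l)
    (hψ : ψ ∈ HermMaps n m) : φ ∘ₗ ψ ∈ HermMaps n l := fun x hx => hφ _ (hψ x hx)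

/-! ### The spaces `L(𝒜, ℬ)` and their duality -/

section AlgMaps

variable {A B D : Alg}

theorem condExp_comp_of_mem {φ : SMap A.dim B.dim} (hφ : φ ∈ algMaps A B) :
    B.condExp ∘ₗ φ = φ := by
  conv_lhs => rw [← hφ.2, ← LinearMap.comp_assoc, B.condExp_idem, hφ.2]

theorem comp_condExp_of_mem {φ : SMap A.dim B.dim} (hφ : φ ∈ algMaps A B) :
    φ ∘ₗ A.condExp = φ := by
  conv_lhs => rw [← hφ.2, LinearMap.comp_assoc, LinearMap.comp_assoc, A.condExp_idem, hφ.2]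

theorem algMaps_comp {φ : SMap B.dim D.dim} {ψ : SMap A.dim B.dim} (hφ : φ ∈ algMaps B D)
    (hψ : ψ ∈ algMaps A B) : φ ∘ₗ ψ ∈ algMaps A D := by
  refine ⟨hermMaps_comp hφ.1 hψ.1, ?_⟩
  rw [LinearMap.comp_assoc, comp_condExp_of_mem hψ, ← LinearMap.comp_assoc,
    condExp_comp_of_mem hφ]

theorem compress_mem_algMaps {φ : SMap A.dim B.dim} (hφ : φ ∈ HermMaps A.dim B.dim) :
    B.condExp ∘ₗ φ ∘ₗ A.condExp ∈ algMaps A B := by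
  refine ⟨hermMaps_comp B.condExp_mem_hermMaps (hermMaps_comp hφ A.condExp_mem_hermMaps), ?_⟩
  rw [LinearMap.comp_assoc, LinearMap.comp_assoc, A.condExp_idem, ← LinearMap.comp_assoc,
    B.condExp_idem]

theorem algMaps_add {φ ψ : SMap A.dim B.dim} (hφ : φ ∈ algMaps A B) (hψ : ψ ∈ algMaps A B) :
    φ + ψ ∈ algMaps A B :=
  ⟨add_mem hφ.1 hψ.1, by rw [LinearMap.add_comp, LinearMap.comp_add, hφ.2, hψ.2]⟩

theorem algMaps_smul (c : ℝ) {φ : SMap A.dim B.dim} (hφ : φ ∈ algMaps A B) :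
    c • φ ∈ algMaps A B := by
  refine ⟨Submodule.smul_mem _ c hφ.1, ?_⟩
  conv_rhs => rw [← hφ.2]
  refine LinearMap.ext fun a => ?_
  have h : ∀ y : Mat B.dim, B.condExp (c • y) = c • B.condExp y := fun y =>
    (B.condExp.restrictScalars ℝ).map_smul c y
  simp [h]

/-- `L(𝒜, ℬ)` as a real linear space. -/
def algMapsSubmodule (A B : Alg) : Submodule ℝ (SMap A.dim B.dim) where
  carrier := algMaps A B
  add_mem' := algMaps_add
  zero_mem' := ⟨zero_mem _, by simp⟩
  smul_mem' c _ h := algMaps_smul c h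

theorem algMaps_sub {φ ψ : SMap A.dim B.dim} (hφ : φ ∈ algMaps A B) (hψ : ψ ∈ algMaps A B) :
    φ - ψ ∈ algMaps A B := (algMapsSubmodule A B).sub_mem hφ hψ

/-- A representing map can be symmetrised under `conjMap` and compressed by the conditional
expectations; neither operation changes its pairing with `ξ` in `L(𝒜, ℬ)`. -/
theorem exists_pairing_eq_on_algMaps (f : SMap A.dim B.dim →ₗ[ℝ] ℝ) :
    ∃ Γ ∈ algMaps B A, ∀ ξ ∈ algMaps A B, f ξ = pairing ξ Γ := by
  obtain ⟨G, hG⟩ := exists_pairing_eq f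
  refine ⟨A.condExp ∘ₗ ((1 / 2 : ℝ) • (G + conjMap G)) ∘ₗ B.condExp,
    compress_mem_algMaps (Submodule.smul_mem _ _ (add_conjMap_mem_hermMaps G)), fun ξ hξ => ?_⟩
  have h1 : pairing ξ (conjMap G) = pairing ξ G := by
    conv_lhs => rw [pairing, ← conjMap_eq_self hξ.1, ← conjMap_comp, sFun_conjMap]
    rfl
  rw [← pairing_comp, comp_condExp_of_mem hξ, pairing_comm, pairing_comp, condExp_comp_of_mem hξ,
    pairing_comm, pairing_smul_right, pairing_add_right, h1, hG]
  ring

end AlgMaps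

/-! ### Cones and channels between algebras -/

section Cones

variable {P : ConeFamily} {A B D : Alg}

theorem algCone_add (hP : Admissible P) {φ ψ : SMap A.dim B.dim} (hφ : φ ∈ algCone P A B)
    (hψ : ψ ∈ algCone P A B) : φ + ψ ∈ algCone P A B :=
  ⟨(hP.proper _ _).add_mem _ hφ.1 _ hψ.1, algMaps_add hφ.2 hψ.2⟩

theorem algCone_smul (hP : Admissible P) {c : ℝ} (hc : 0 ≤ c) {φ : SMap A.dim B.dim}
    (hφ : φ ∈ algCone P A B) : c • φ ∈ algCone P A B :=
  ⟨(hP.proper _ _).smul_mem c hc _ hφ.1, algMaps_smul c hφ.2⟩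

theorem algCone_zero (hP : Admissible P) : (0 : SMap A.dim B.dim) ∈ algCone P A B :=
  ⟨(hP.proper _ _).zero_mem, (algMapsSubmodule A B).zero_mem⟩

theorem algCone_comp (hP : Admissible P) {φ : SMap B.dim D.dim} {ψ : SMap A.dim B.dim}
    (hφ : φ ∈ algCone P B D) (hψ : ψ ∈ algCone P A B) : φ ∘ₗ ψ ∈ algCone P A D :=
  ⟨hP.comp_mem _ _ _ ψ hψ.1 φ hφ.1, algMaps_comp hφ.2 hψ.2⟩

theorem compress_mem_algCone (hP : Admissible P) {φ : SMap A.dim B.dim}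
    (hφ : φ ∈ P A.dim B.dim) : B.condExp ∘ₗ φ ∘ₗ A.condExp ∈ algCone P A B :=
  ⟨hP.cp_comp_mem _ _ _ _ _ A.condExp_mem_cp _ hφ _ B.condExp_mem_cp,
    compress_mem_algMaps ((hP.proper _ _).subset_herm _ hφ)⟩

theorem channels_comp (hP : Admissible P) {φ : SMap B.dim D.dim} {ψ : SMap A.dim B.dim}
    (hφ : φ ∈ channels P B D) (hψ : ψ ∈ channels P A B) : φ ∘ₗ ψ ∈ channels P A D :=
  ⟨algCone_comp hP hφ.1 hψ.1, fun a => by rw [LinearMap.comp_apply, hφ.2, hψ.2]⟩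

theorem inv_smul_mem_channels (hP : Admissible P) {φ : SMap A.dim B.dim}
    (hφ : φ ∈ algCone P A B) {r : ℝ} (hr : 0 < r) (htr : ∀ a, (φ a).trace = r • a.trace) :
    r⁻¹ • φ ∈ channels P A B := by
  refine ⟨algCone_smul hP (inv_nonneg.2 hr.le) hφ, fun a => ?_⟩
  rw [LinearMap.smul_apply, Matrix.trace_smul, htr, smul_smul, inv_mul_cancel₀ hr.ne', one_smul]

/-- The density of the functional `a ↦ Tr φ(a)`. -/
def traceDensity {n m : ℕ} (φ : SMap n m) : Mat n :=
  Matrix.of fun j i => (φ (Matrix.single i j 1)).trace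

theorem trace_traceDensity_mul {n m : ℕ} (φ : SMap n m) (a : Mat n) :
    (traceDensity φ * a).trace = (φ a).trace := by
  conv_rhs => rw [Matrix.matrix_eq_sum_single a]
  have h : ∀ i j, Matrix.single i j (a i j) = a i j • Matrix.single i j (1 : ℂ) := fun i j => by
    simp
  simp only [h, map_sum, map_smul, Matrix.trace_sum, Matrix.trace_smul, smul_eq_mul]
  rw [Finset.sum_comm, Matrix.trace]
  refine Finset.sum_congr rfl fun i _ => ?_
  rw [Matrix.diag, Matrix.mul_apply]
  exact Finset.sum_congr rfl fun j _ => mul_comm _ _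

theorem traceDensity_isHermitian {n m : ℕ} {φ : SMap n m} (hφ : φ ∈ HermMaps n m) :
    (traceDensity φ).IsHermitian := by
  ext i j
  simp only [traceDensity, Matrix.conjTranspose_apply, Matrix.of_apply]
  conv_lhs => rw [← conjMap_eq_self hφ]
  simp [conjMap, Matrix.trace_conjTranspose]

/-- The trace defect `t Tr a - Tr φ(a)` is a positive functional for large `t`. Sending it into the
maximally mixed state gives an entanglement breaking map that completes `φ` to `t` times a channel.
-/
theorem exists_channel_sub_mem (hP : Admissible P) {φ : SMap A.dim B.dim}
    (hφ : φ ∈ algCone P A B) :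
    ∃ t : ℝ, 0 < t ∧ ∃ α ∈ channels P A B, t • α - φ ∈ algCone P A B := by
  obtain ⟨t, ht, hpsd⟩ := exists_smul_one_sub_posSemidef (traceDensity_isHermitian hφ.2.1)
  set G : Mat A.dim := t • (1 : Mat A.dim) - traceDensity φ with hG
  have hGtr : ∀ a, (G * a).trace = t • a.trace - (φ a).trace := fun a => by
    rw [hG, sub_mul, Matrix.trace_sub, trace_traceDensity_mul, smul_mul_assoc, one_mul,
      Matrix.trace_smul]
  have hd : (B.dim : ℂ) ≠ 0 := Nat.cast_ne_zero.2 B.dim_pos.ne'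
  set σ : Mat B.dim := (B.dim : ℂ)⁻¹ • (1 : Mat B.dim) with hσ
  have hσpsd : σ.PosSemidef := Matrix.PosSemidef.one.smul (by positivity)
  have hσtr : σ.trace = 1 := by
    rw [hσ, Matrix.trace_smul, Matrix.trace_one, Fintype.card_fin, smul_eq_mul,
      inv_mul_cancel₀ hd]
  let χ : SMap A.dim B.dim :=
    (Matrix.traceLinearMap (Fin A.dim) ℂ ℂ ∘ₗ LinearMap.mulLeft ℂ G).smulRight σ
  have hχ : ∀ a, χ a = (G * a).trace • σ := fun a => rfl
  have hχP : χ ∈ P A.dim B.dim := hP.eb_subset _ _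
    ⟨1, fun _ => G, fun _ => σ, fun _ => hpsd, fun _ => hσpsd, fun a => by simp [hχ]⟩
  have hχmem : χ ∈ algCone P A B := by
    refine ⟨hχP, (hP.proper _ _).subset_herm _ hχP, LinearMap.ext fun a => ?_⟩
    have h1 : φ (A.condExp a) = φ a := LinearMap.congr_fun (comp_condExp_of_mem hφ.2) a
    rw [LinearMap.comp_apply, LinearMap.comp_apply, hχ, hχ, map_smul, hσ, map_smul,
      B.condExp_one, hGtr, hGtr, h1, A.trace_condExp]
  refine ⟨t, ht, t⁻¹ • (φ + χ), inv_smul_mem_channels hP (algCone_add hP hφ hχmem) ht fun a => ?_,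
    ?_⟩
  · rw [LinearMap.add_apply, Matrix.trace_add, hχ, Matrix.trace_smul, hσtr, hGtr, smul_eq_mul]
    ring
  · rw [smul_smul, mul_inv_cancel₀ ht.ne', one_smul, add_sub_cancel_left]
    exact hχmem

theorem exists_channel_dominating (hP : Admissible P) {ξ : SMap A.dim B.dim}
    (hξ : ξ ∈ algMaps A B) :
    ∃ t : ℝ, 0 < t ∧ ∃ α ∈ channels P A B,
      t • α - ξ ∈ algCone P A B ∧ t • α + ξ ∈ algCone P A B := by
  obtain ⟨φ₁, h₁, φ₂, h₂, h⟩ := (hP.proper _ _).generating ξ hξ.1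
  have h₁' := compress_mem_algCone (A := A) (B := B) hP h₁
  have h₂' := compress_mem_algCone (A := A) (B := B) hP h₂
  have h' : ξ = B.condExp ∘ₗ φ₁ ∘ₗ A.condExp - B.condExp ∘ₗ φ₂ ∘ₗ A.condExp := by
    rw [← LinearMap.comp_sub, ← LinearMap.sub_comp, ← h, hξ.2]
  set ψ₁ := B.condExp ∘ₗ φ₁ ∘ₗ A.condExp
  set ψ₂ := B.condExp ∘ₗ φ₂ ∘ₗ A.condExp
  -- Dominating the sum `ψ₁ + ψ₂` handles both signs, since it differs from `±(ψ₁ - ψ₂)` by twice a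
  -- cone element.
  obtain ⟨t, ht, α, hα, hdom⟩ := exists_channel_sub_mem hP (algCone_add hP h₁' h₂')
  refine ⟨t, ht, α, hα, ?_, ?_⟩
  · have := algCone_add hP hdom (algCone_smul hP zero_le_two h₂')
    convert this using 1
    rw [h', two_smul]; abel
  · have := algCone_add hP hdom (algCone_smul hP zero_le_two h₁')
    convert this using 1
    rw [h', two_smul]; abel

theorem channels_nonempty (hP : Admissible P) (A B : Alg) : (channels P A B).Nonempty := by
  obtain ⟨_, _, α, hα, _⟩ := exists_channel_sub_mem hP (algCone_zero hP (A := A) (B := B))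
  exact ⟨α, hα⟩

theorem channels_convex (hP : Admissible P) : Convex ℝ (channels P A B) := by
  intro φ hφ ψ hψ s t hs ht hst
  refine ⟨algCone_add hP (algCone_smul hP hs hφ.1) (algCone_smul hP ht hψ.1), fun a => ?_⟩
  rw [LinearMap.add_apply, LinearMap.smul_apply, LinearMap.smul_apply, Matrix.trace_add,
    Matrix.trace_smul, Matrix.trace_smul, hφ.2, hψ.2, ← add_smul, hst, one_smul]

/-- The real functional `φ ↦ Tr φ(1)`. -/
def traceOne (n m : ℕ) : SMap n m →ₗ[ℝ] ℝ where
  toFun φ := (φ 1).trace.re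
  map_add' φ ψ := by simp
  map_smul' c φ := by simp

theorem traceOne_nonneg {n m : ℕ} {φ : SMap n m} (hφ : φ ∈ Pos n m) : 0 ≤ traceOne n m φ :=
  (Complex.le_def.1 (hφ.2 1 Matrix.PosSemidef.one).trace_nonneg).1

/-- Vanishing trace of the positive matrix `φ 1` gives `φ 1 = 0`. As `a ≤ t • 1` for Hermitian `a`,
positivity gives `φ a ≤ 0`; the same for `-a` gives `φ a = 0`. -/
theorem eq_zero_of_traceOne_eq_zero {n m : ℕ} {φ : SMap n m} (hφ : φ ∈ Pos n m)
    (h : traceOne n m φ = 0) : φ = 0 := by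
  have h1 : φ 1 = 0 := by
    have hpsd := hφ.2 1 Matrix.PosSemidef.one
    refine hpsd.trace_eq_zero_iff.1 (Complex.ext h ?_)
    exact (Complex.le_def.1 hpsd.trace_nonneg).2.symm
  have key : ∀ a : Mat n, a.IsHermitian → (-(φ a)).PosSemidef := by
    intro a ha
    obtain ⟨t, -, ht⟩ := exists_smul_one_sub_posSemidef ha
    have := hφ.2 _ ht
    rwa [map_sub, ← algebraMap_smul ℂ t (1 : Mat n), map_smul, h1, smul_zero, zero_sub] at this
  have key2 : ∀ a : Mat n, a.IsHermitian → φ a = 0 := by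
    intro a ha
    have h2 := key a ha
    have h3 := key (-a) ha.neg
    rw [map_neg, neg_neg] at h3
    refine h3.trace_eq_zero_iff.1 (le_antisymm ?_ h3.trace_nonneg)
    have := h2.trace_nonneg
    rwa [Matrix.trace_neg, neg_nonneg] at this
  refine LinearMap.ext fun a => ?_
  rw [← realPart_add_I_smul_imaginaryPart a, map_add, map_smul, key2 _ (realPart a).2,
    key2 _ (imaginaryPart a).2, smul_zero, add_zero, LinearMap.zero_apply]

theorem traceOne_channel {φ : SMap A.dim B.dim} (hφ : φ ∈ channels P A B) :
    traceOne _ _ φ = A.dim := by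
  simp [traceOne, hφ.2]

end Cones

/-! ### Closedness and compactness, for an auxiliary norm on the finite-dimensional space of maps -/

section Topology

variable {P : ConeFamily} {A B D : Alg}

/-- The values of a map on the matrix units, entrywise. -/
def matUnitValues (n m : ℕ) : SMap n m →ₗ[ℝ] (Fin n → Fin n → Fin m → Fin m → ℂ) where
  toFun φ i j k l := φ (Matrix.single i j 1) k l
  map_add' _ _ := rfl
  map_smul' _ _ := rfl

theorem matUnitValues_injective (n m : ℕ) : Function.Injective (matUnitValues n m) := by
  intro φ ψ h
  rw [eq_sum_elemMap φ, eq_sum_elemMap ψ]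
  refine Finset.sum_congr rfl fun k _ => Finset.sum_congr rfl fun l _ =>
    Finset.sum_congr rfl fun i _ => Finset.sum_congr rfl fun j _ => ?_
  have : φ (Matrix.single i j 1) k l = ψ (Matrix.single i j 1) k l :=
    congrFun (congrFun (congrFun (congrFun h i) j) k) l
  rw [this]

/-- The norm of a linear map as the largest modulus of its values on the matrix units. -/
noncomputable abbrev smapNormedAddCommGroup (n m : ℕ) : NormedAddCommGroup (SMap n m) :=
  NormedAddCommGroup.induced _ _ (matUnitValues n m) (matUnitValues_injective n m)

attribute [local instance] smapNormedAddCommGroup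

/-- The normed space structure of `smapNormedAddCommGroup`. -/
noncomputable abbrev smapNormedSpace (n m : ℕ) : NormedSpace ℝ (SMap n m) :=
  NormedSpace.induced ℝ (SMap n m) (Fin n → Fin n → Fin m → Fin m → ℂ) (matUnitValues n m)

attribute [local instance] smapNormedSpace

/-- Evaluation at a matrix, as a real linear map. -/
def evalLinear {n m : ℕ} (x : Mat n) : SMap n m →ₗ[ℝ] Mat m where
  toFun φ := φ x
  map_add' _ _ := rfl
  map_smul' _ _ := rfl

theorem continuous_of_linear {n m : ℕ} {V : Type*} [AddCommGroup V] [TopologicalSpace V]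
    [IsTopologicalAddGroup V] [Module ℝ V] [ContinuousSMul ℝ V] (f : SMap n m →ₗ[ℝ] V) :
    Continuous f := f.continuous_of_finiteDimensional

theorem cone_isClosed (hP : Admissible P) (n m : ℕ) : IsClosed (P n m) := by
  refine IsSeqClosed.isClosed fun u φ hu hlim => ?_
  refine (hP.proper n m).closed u φ hu fun x => ?_
  have hc : Continuous (evalLinear (m := m) x) := continuous_of_linear _
  exact (hc.tendsto φ).comp hlim

theorem algMaps_isClosed (A B : Alg) : IsClosed (algMaps A B) :=
  (algMapsSubmodule A B).closed_of_finiteDimensional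

theorem algCone_isClosed (hP : Admissible P) (A B : Alg) : IsClosed (algCone P A B) :=
  (cone_isClosed hP _ _).inter (algMaps_isClosed A B)

/-- `traceOne` is strictly positive on the compact set of unit vectors of the cone, hence bounded
below there by a positive constant; homogeneity does the rest. As `traceOne` is constant on
channels, this bounds them. -/
theorem exists_norm_le_traceOne (hP : Admissible P) (n m : ℕ) :
    ∃ C : ℝ, 0 < C ∧ ∀ φ ∈ P n m, ‖φ‖ ≤ C * traceOne n m φ := by
  have hcomp : IsCompact (P n m ∩ Metric.sphere 0 1) :=
    have : ProperSpace (SMap n m) := FiniteDimensional.proper ℝ _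
    (isCompact_sphere 0 1).inter_left (cone_isClosed hP n m)
  have hpos : ∀ φ ∈ P n m ∩ Metric.sphere 0 1, 0 < traceOne n m φ := by
    rintro φ ⟨hφ, hn⟩
    refine lt_of_le_of_ne (traceOne_nonneg (hP.subset_pos _ _ hφ)) fun h => ?_
    rw [eq_zero_of_traceOne_eq_zero (hP.subset_pos _ _ hφ) h.symm] at hn
    simp at hn
  obtain ⟨c, hc, hle⟩ : ∃ c : ℝ, 0 < c ∧ ∀ φ ∈ P n m ∩ Metric.sphere 0 1, c ≤ traceOne n m φ := by
    rcases (P n m ∩ Metric.sphere 0 1).eq_empty_or_nonempty with h | h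
    · exact ⟨1, one_pos, by simp [h]⟩
    · obtain ⟨φ₀, h₀, hmin⟩ := hcomp.exists_isMinOn h
        (continuous_of_linear (traceOne n m)).continuousOn
      exact ⟨_, hpos φ₀ h₀, fun φ hφ => hmin hφ⟩
  refine ⟨c⁻¹, inv_pos.2 hc, fun φ hφ => ?_⟩
  rcases eq_or_ne φ 0 with rfl | h0
  · simp
  have hn : 0 < ‖φ‖ := norm_pos_iff.2 h0
  have := hle (‖φ‖⁻¹ • φ) ⟨(hP.proper _ _).smul_mem _ (inv_nonneg.2 hn.le) _ hφ, by
    rw [mem_sphere_zero_iff_norm, norm_smul, norm_inv, norm_norm, inv_mul_cancel₀ hn.ne']⟩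
  rw [map_smul, smul_eq_mul, le_inv_mul_iff₀ hn] at this
  rwa [le_inv_mul_iff₀ hc, mul_comm]

theorem channels_isCompact (hP : Admissible P) (A B : Alg) : IsCompact (channels P A B) := by
  have : ProperSpace (SMap A.dim B.dim) := FiniteDimensional.proper ℝ _
  obtain ⟨C, hC, hle⟩ := exists_norm_le_traceOne hP A.dim B.dim
  refine (isCompact_closedBall (0 : SMap A.dim B.dim) (C * A.dim)).of_isClosed_subset ?_ ?_
  · have : channels P A B = algCone P A B ∩ ⋂ a, {φ | (φ a).trace = a.trace} := by
      ext φ; simp [channels]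
    rw [this]
    refine (algCone_isClosed hP A B).inter (isClosed_iInter fun a => ?_)
    have hc : Continuous ((Matrix.traceLinearMap (Fin B.dim) ℝ ℂ) ∘ₗ
      evalLinear (m := B.dim) a) := continuous_of_linear _
    exact isClosed_eq hc continuous_const
  · intro φ hφ
    rw [mem_closedBall_zero_iff, ← traceOne_channel hφ]
    exact hle φ hφ.1.1

theorem norm_le_of_channel_dominating (hP : Admissible P) (A B : Alg) :
    ∃ C : ℝ, 0 < C ∧ ∀ (t : ℝ) (α ξ : SMap A.dim B.dim), α ∈ channels P A B →
      t • α - ξ ∈ algCone P A B → t • α + ξ ∈ algCone P A B → ‖ξ‖ ≤ C * t := by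
  obtain ⟨C, hC, hle⟩ := exists_norm_le_traceOne hP A.dim B.dim
  have hd : (0 : ℝ) < A.dim := Nat.cast_pos.2 A.dim_pos
  refine ⟨C * A.dim, by positivity, fun t α ξ hα h₁ h₂ => ?_⟩
  have h₁' := hle _ h₁.1
  have h₂' := hle _ h₂.1
  rw [map_sub, map_smul, traceOne_channel hα, smul_eq_mul] at h₁'
  rw [map_add, map_smul, traceOne_channel hα, smul_eq_mul] at h₂'
  have h3 : ‖(2 : ℝ) • ξ‖ ≤ ‖t • α + ξ‖ + ‖t • α - ξ‖ := by
    refine le_trans (le_of_eq ?_) (norm_sub_le _ _)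
    congr 1
    rw [two_smul]; abel
  rw [norm_smul, Real.norm_ofNat] at h3
  linarith

end Topology

/-! ### The diamond norm and its dual -/

section Norms

variable {P : ConeFamily} {A A' B D : Alg}

attribute [local instance] smapNormedAddCommGroup smapNormedSpace

theorem diamondNorm_le {t : ℝ} (ht : 0 < t) {α φ : SMap A.dim B.dim} (hα : α ∈ channels P A B)
    (h₁ : t • α - φ ∈ algCone P A B) (h₂ : t • α + φ ∈ algCone P A B) :
    diamondNorm P A B φ ≤ t :=
  csInf_le ⟨0, fun _ h => h.1.le⟩ ⟨ht, α, hα, h₁, h₂⟩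

theorem exists_channel_of_diamondNorm_lt (hP : Admissible P) {φ : SMap A.dim B.dim}
    (hφ : φ ∈ algMaps A B) {s : ℝ} (hs : diamondNorm P A B φ < s) :
    0 < s ∧ ∃ α ∈ channels P A B, s • α - φ ∈ algCone P A B ∧ s • α + φ ∈ algCone P A B := by
  obtain ⟨t₀, ht₀, α₀, hα₀, h₀⟩ := exists_channel_dominating hP hφ
  have hne : {t : ℝ | 0 < t ∧ ∃ b ∈ channels P A B,
      t • b - φ ∈ algCone P A B ∧ t • b + φ ∈ algCone P A B}.Nonempty := ⟨t₀, ht₀, α₀, hα₀, h₀⟩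
  obtain ⟨t, ⟨ht, α, hα, h₁, h₂⟩, hts⟩ := exists_lt_of_csInf_lt hne hs
  have h := algCone_smul hP (sub_nonneg.2 hts.le) hα.1
  refine ⟨ht.trans hts, α, hα, ?_, ?_⟩
  · convert algCone_add hP h h₁ using 1
    rw [sub_smul]; abel
  · convert algCone_add hP h h₂ using 1
    rw [sub_smul]; abel

theorem diamondNorm_channel_le_one (hP : Admissible P) {α : SMap A.dim B.dim}
    (hα : α ∈ channels P A B) : diamondNorm P A B α ≤ 1 := by
  refine diamondNorm_le one_pos hα ?_ ?_
  · rw [one_smul, sub_self]; exact algCone_zero hP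
  · rw [one_smul]; exact algCone_add hP hα.1 hα.1

theorem dualDiamondNorm_bddAbove (hP : Admissible P) (Γ : SMap B.dim D.dim) :
    BddAbove {r : ℝ | ∃ ξ ∈ algMaps D B, diamondNorm P D B ξ ≤ 1 ∧ r = pairing Γ ξ} := by
  have : ProperSpace (SMap D.dim B.dim) := FiniteDimensional.proper ℝ _
  obtain ⟨C, -, hle⟩ := norm_le_of_channel_dominating hP D B
  have hc : Continuous (pairingLeft Γ) := continuous_of_linear _
  obtain ⟨b, hb⟩ := ((isCompact_closedBall (0 : SMap D.dim B.dim) (C * 2)).image hc).bddAbove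
  refine ⟨b, ?_⟩
  rintro r ⟨ξ, hξ, hn, rfl⟩
  obtain ⟨-, α, hα, h₁, h₂⟩ := exists_channel_of_diamondNorm_lt hP hξ (hn.trans_lt one_lt_two)
  rw [pairing_comm]
  exact hb ⟨ξ, mem_closedBall_zero_iff.2 (hle _ _ _ hα h₁ h₂), rfl⟩

theorem pairing_le_dualDiamondNorm (hP : Admissible P) (Γ : SMap B.dim D.dim)
    {ξ : SMap D.dim B.dim} (hξ : ξ ∈ algMaps D B) (hn : diamondNorm P D B ξ ≤ 1) :
    pairing ξ Γ ≤ dualDiamondNorm P B D Γ :=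
  le_csSup (dualDiamondNorm_bddAbove hP Γ) ⟨ξ, hξ, hn, pairing_comm _ _⟩

theorem pairing_channel_le (hP : Admissible P) (Γ : SMap B.dim D.dim) {α : SMap D.dim B.dim}
    (hα : α ∈ channels P D B) : pairing α Γ ≤ dualDiamondNorm P B D Γ :=
  pairing_le_dualDiamondNorm hP Γ hα.1.2 (diamondNorm_channel_le_one hP hα)

theorem dualDiamondNorm_le (hP : Admissible P) {Γ : SMap B.dim D.dim} {c : ℝ}
    (h : ∀ ξ ∈ algMaps D B, diamondNorm P D B ξ ≤ 1 → pairing ξ Γ ≤ c) :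
    dualDiamondNorm P B D Γ ≤ c := by
  obtain ⟨α, hα⟩ := channels_nonempty hP D B
  refine csSup_le ⟨_, α, hα.1.2, diamondNorm_channel_le_one hP hα, rfl⟩ ?_
  rintro r ⟨ξ, hξ, hn, rfl⟩
  rw [pairing_comm]
  exact h ξ hξ hn

/-- The diamond norm is an infimum, so dominating channels are available only at radius `r + δ`;
this removes the slack, whatever the sign of `d`. -/
theorem le_mul_of_forall_pos {x r d : ℝ} (h : ∀ δ > 0, x ≤ (r + δ) * d) :
    x ≤ r * d := by
  have hc : Filter.Tendsto (fun δ : ℝ => (r + δ) * d) (nhdsWithin 0 (Set.Ioi 0))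
      (nhds ((r + 0) * d)) := by
    have : Continuous fun δ : ℝ => (r + δ) * d := by fun_prop
    exact (this.tendsto 0).mono_left nhdsWithin_le_nhds
  rw [add_zero] at hc
  exact ge_of_tendsto hc (Filter.eventually_of_mem self_mem_nhdsWithin h)

theorem pairing_le_diamondNorm_mul (hP : Admissible P) (Γ : SMap B.dim D.dim)
    {ξ : SMap D.dim B.dim} (hξ : ξ ∈ algMaps D B) {r : ℝ} (hn : diamondNorm P D B ξ ≤ r) :
    pairing ξ Γ ≤ r * dualDiamondNorm P B D Γ := by
  refine le_mul_of_forall_pos fun δ hδ => ?_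
  obtain ⟨hs, α, hα, h₁, h₂⟩ :=
    exists_channel_of_diamondNorm_lt hP hξ (hn.trans_lt (lt_add_of_pos_right r hδ))
  have hs' := (inv_pos.2 hs).le
  have hle : diamondNorm P D B ((r + δ)⁻¹ • ξ) ≤ 1 := by
    refine diamondNorm_le one_pos hα ?_ ?_
    · convert algCone_smul hP hs' h₁ using 1
      rw [smul_sub, smul_smul, inv_mul_cancel₀ hs.ne']
    · convert algCone_smul hP hs' h₂ using 1
      rw [smul_add, smul_smul, inv_mul_cancel₀ hs.ne']
  have := pairing_le_dualDiamondNorm hP Γ (algMaps_smul _ hξ) hle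
  rwa [pairing_smul, inv_mul_le_iff₀ hs] at this

theorem dualDiamondNorm_eq_pairing_channel (hP : Admissible P) {Γ : SMap B.dim D.dim}
    (hΓ : Γ ∈ dualFamily P B.dim D.dim) :
    ∃ α ∈ channels P D B, dualDiamondNorm P B D Γ = pairing α Γ := by
  obtain ⟨α, hα, hmax⟩ := (channels_isCompact hP D B).exists_isMaxOn (channels_nonempty hP D B)
    (continuous_of_linear (pairingLeft Γ)).continuousOn
  refine ⟨α, hα, le_antisymm (dualDiamondNorm_le hP fun ξ hξ hn => ?_)
    (pairing_channel_le hP Γ hα)⟩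
  rw [← one_mul (pairing α Γ)]
  refine le_mul_of_forall_pos fun δ hδ => ?_
  obtain ⟨hs, μ, hμ, h₁, -⟩ :=
    exists_channel_of_diamondNorm_lt hP hξ (hn.trans_lt (lt_add_of_pos_right 1 hδ))
  have h3 := hΓ.2 _ h₁.1
  rw [pairing_sub, pairing_smul] at h3
  have h4 : pairing μ Γ ≤ pairing α Γ := hmax hμ
  nlinarith

/-- A difference of channels is controlled by half of its diamond norm on the dual cone. -/
theorem pairing_sub_channels_le (hP : Admissible P) {Γ : SMap B.dim D.dim}
    (hΓ : Γ ∈ dualFamily P B.dim D.dim) {φ ψ : SMap D.dim B.dim} (hφ : φ ∈ channels P D B)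
    (hψ : ψ ∈ channels P D B) {r : ℝ} (hn : diamondNorm P D B (φ - ψ) ≤ 2 * r) :
    pairing φ Γ ≤ pairing ψ Γ + r * dualDiamondNorm P B D Γ := by
  suffices h : pairing (φ - ψ) Γ ≤ r * dualDiamondNorm P B D Γ by
    rw [pairing_sub] at h; linarith
  refine le_mul_of_forall_pos fun δ hδ => ?_
  obtain ⟨hs, α, hα, h₁, h₂⟩ := exists_channel_of_diamondNorm_lt hP (algMaps_sub hφ.1.2 hψ.1.2)
    (s := 2 * (r + δ)) (by linarith)
  -- `φ - ψ` annihilates the trace, so `s α + (φ - ψ)` is `s` times a channel, where `s = 2 (r +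
  -- δ)`. Its pairing is at most `s ‖Γ‖^⋄`; adding `⟨φ - ψ, Γ⟩ ≤ s ⟨α, Γ⟩` cancels `α` and leaves
  -- the factor one half.
  have hch := inv_smul_mem_channels hP h₂ hs fun a => by
    rw [LinearMap.add_apply, LinearMap.sub_apply, LinearMap.smul_apply, Matrix.trace_add,
      Matrix.trace_sub, hφ.2, hψ.2, sub_self, add_zero, Matrix.trace_smul, hα.2]
  have h3 := pairing_channel_le hP Γ hch
  rw [pairing_smul, inv_mul_le_iff₀ hs, pairing_add, pairing_smul] at h3
  have h4 := hΓ.2 _ h₁.1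
  rw [pairing_sub, pairing_smul] at h4
  linarith

theorem exists_pairing_separating {K : Set (SMap D.dim B.dim)} (hconv : Convex ℝ K)
    (hcl : IsClosed K) (hK : K ⊆ algMaps D B) {x : SMap D.dim B.dim} (hx : x ∈ algMaps D B)
    (hxK : x ∉ K) :
    ∃ Γ ∈ algMaps B D, ∃ u : ℝ, (∀ a ∈ K, pairing a Γ < u) ∧ u < pairing x Γ := by
  obtain ⟨f, u, h₁, h₂⟩ := geometric_hahn_banach_closed_point hconv hcl hxK
  obtain ⟨Γ, hΓ, h⟩ := exists_pairing_eq_on_algMaps (A := D) (B := B) f.toLinearMap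
  exact ⟨Γ, hΓ, u, fun a ha => (h a (hK ha)).symm.trans_lt (h₁ a ha),
    h₂.trans_eq (h x hx)⟩

end Norms

/-! ### Separation arguments and the equivalences -/

section Deficiency

variable {P : ConeFamily} {A A' B D : Alg}

attribute [local instance] smapNormedAddCommGroup smapNormedSpace

/-- Composition with a fixed map on the left, as a real linear map. -/
def postcomp {n m l : ℕ} (φ : SMap m l) : SMap n m →ₗ[ℝ] SMap n l where
  toFun χ := φ ∘ₗ χ
  map_add' χ η := LinearMap.comp_add χ η φ
  map_smul' c χ := LinearMap.ext fun a => (φ.restrictScalars ℝ).map_smul c (χ a)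

theorem postcomp_image_isCompact (hP : Admissible P) (D : Alg) (Ψ : SMap A'.dim B.dim) :
    IsCompact (postcomp Ψ '' channels P D A') :=
  (channels_isCompact hP D A').image (continuous_of_linear _)

theorem postcomp_image_convex (hP : Admissible P) (D : Alg) (Ψ : SMap A'.dim B.dim) :
    Convex ℝ (postcomp Ψ '' channels P D A') := (channels_convex hP).linear_image _

theorem dualDiamondNorm_comp_eq (hP : Admissible P) {Φ : SMap A.dim B.dim}
    (hΦ : Φ ∈ channels P A B) {Γ : SMap B.dim D.dim} (hΓ : Γ ∈ dualFamily P B.dim D.dim) :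
    (∃ β ∈ channels P D A, dualDiamondNorm P A D (Γ ∘ₗ Φ) = pairing (Φ ∘ₗ β) Γ) ∧
      ∀ β ∈ channels P D A, pairing (Φ ∘ₗ β) Γ ≤ dualDiamondNorm P A D (Γ ∘ₗ Φ) := by
  have hmem : Γ ∘ₗ Φ ∈ dualFamily P A.dim D.dim :=
    ⟨hermMaps_comp hΓ.1 hΦ.1.2.1, fun φ hφ => by
      rw [← pairing_comp_left]; exact hΓ.2 _ (hP.comp_mem _ _ _ _ hφ _ hΦ.1.1)⟩
  refine ⟨?_, fun β hβ => ?_⟩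
  · obtain ⟨β, hβ, h⟩ := dualDiamondNorm_eq_pairing_channel hP hmem
    exact ⟨β, hβ, by rw [h, pairing_comp_left]⟩
  · rw [pairing_comp_left]; exact pairing_channel_le hP _ hβ

theorem preDeficientFor_iff_dualDiamondNorm_le (hP : Admissible P) {Φ : SMap A.dim B.dim}
    (hΦ : Φ ∈ channels P A B) {Ψ : SMap A'.dim B.dim} (hΨ : Ψ ∈ channels P A' B) (ε : ℝ) :
    PreDeficientFor (A := A) (A' := A') (B := B) P ε D Ψ Φ ↔
      ∀ Γ ∈ algDualCone P B D,
        dualDiamondNorm P A D (Γ ∘ₗ Φ) ≤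
          dualDiamondNorm P A' D (Γ ∘ₗ Ψ) + ε * dualDiamondNorm P B D Γ := by
  constructor
  · intro h Γ hΓ
    obtain ⟨β, hβ, hmax⟩ := (dualDiamondNorm_comp_eq hP hΦ hΓ.1).1
    obtain ⟨β', hβ', hle⟩ := h Γ hΓ β hβ
    have := (dualDiamondNorm_comp_eq hP hΨ hΓ.1).2 β' hβ'
    linarith
  · intro h Γ hΓ β hβ
    obtain ⟨β', hβ', hmax⟩ := (dualDiamondNorm_comp_eq hP hΨ hΓ.1).1
    have := (dualDiamondNorm_comp_eq hP hΦ hΓ.1).2 β hβ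
    have := h Γ hΓ
    exact ⟨β', hβ', by linarith⟩

open scoped Pointwise in
theorem exists_eq_sub_of_preDeficientFor (hP : Admissible P) {Φ : SMap A.dim B.dim}
    (hΦ : Φ ∈ channels P A B) {Ψ : SMap A'.dim B.dim} (hΨ : Ψ ∈ channels P A' B) {ε : ℝ}
    (h : PreDeficientFor (A := A) (A' := A') (B := B) P ε D Ψ Φ)
    {β : SMap D.dim A.dim} (hβ : β ∈ channels P D A) :
    ∃ β' ∈ channels P D A', ∃ μ ∈ channels P D B, ∃ p ∈ algCone P D B,
      Φ ∘ₗ β - Ψ ∘ₗ β' = ε • μ - p := by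
  set K : Set (SMap D.dim B.dim) :=
    -algCone P D B + (postcomp Ψ '' channels P D A' + ε • channels P D B) with hK
  have hmemK : ∀ p ∈ algCone P D B, ∀ β' ∈ channels P D A', ∀ μ ∈ channels P D B,
      -p + (Ψ ∘ₗ β' + ε • μ) ∈ K := fun p hp β' hβ' μ hμ =>
    Set.add_mem_add (Set.neg_mem_neg.2 hp)
      (Set.add_mem_add ⟨β', hβ', rfl⟩ (Set.smul_mem_smul_set hμ))
  have hexists : ∀ x ∈ K, ∃ β' ∈ channels P D A', ∃ μ ∈ channels P D B, ∃ p ∈ algCone P D B,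
      x = -p + (Ψ ∘ₗ β' + ε • μ) := by
    rintro _ ⟨p, hp, _, ⟨_, ⟨β', hβ', rfl⟩, _, ⟨μ, hμ, rfl⟩, rfl⟩, rfl⟩
    exact ⟨β', hβ', μ, hμ, -p, hp, by rw [neg_neg]; rfl⟩
  -- The cone is closed but not compact; its sum with a compact set is still closed.
  have hclosed : IsClosed K :=
    (algCone_isClosed hP D B).neg.add_right_of_isCompact
      ((postcomp_image_isCompact hP D Ψ).add ((channels_isCompact hP D B).smul ε))
  have hcone : Convex ℝ (algCone P D B) := fun φ hφ ψ hψ s t hs ht _ =>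
    algCone_add hP (algCone_smul hP hs hφ) (algCone_smul hP ht hψ)
  have hconv : Convex ℝ K :=
    hcone.neg.add ((postcomp_image_convex hP D Ψ).add ((channels_convex hP).smul ε))
  have hsub : K ⊆ algMaps D B := by
    intro x hx
    obtain ⟨β', hβ', μ, hμ, p, hp, rfl⟩ := hexists x hx
    exact algMaps_add ((algMapsSubmodule D B).neg_mem hp.2)
      (algMaps_add (channels_comp hP hΨ hβ').1.2 (algMaps_smul ε hμ.1.2))
  by_cases hx : Φ ∘ₗ β ∈ K
  · obtain ⟨β', hβ', μ, hμ, p, hp, hxe⟩ := hexists _ hx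
    exact ⟨β', hβ', μ, hμ, p, hp, by rw [hxe]; abel⟩
  exfalso
  obtain ⟨Γ, hΓ, u, hu, hux⟩ :=
    exists_pairing_separating hconv hclosed hsub (channels_comp hP hΦ hβ).1.2 hx
  have hKle : ∀ p ∈ algCone P D B, ∀ β' ∈ channels P D A', ∀ μ ∈ channels P D B,
      -pairing p Γ + (pairing (Ψ ∘ₗ β') Γ + ε * pairing μ Γ) < u := fun p hp β' hβ' μ hμ => by
    have := hu _ (hmemK p hp β' hβ' μ hμ)
    have hneg : pairing (-p) Γ = -pairing p Γ := (pairingLeft Γ).map_neg p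
    rwa [pairing_add, pairing_add, pairing_smul, hneg] at this
  -- `K` is unbounded in the directions `-p`, so a functional bounded above on `K` must be
  -- nonnegative on the cone. Compression extends this from `𝒫(𝒟, ℬ)` to the full cone.
  have hΓdual : Γ ∈ algDualCone P B D := by
    refine ⟨⟨hΓ.1, fun φ hφ => ?_⟩, hΓ⟩
    have hφ' := compress_mem_algCone (A := D) (B := B) hP hφ
    have heq : pairing φ Γ = pairing (B.condExp ∘ₗ φ ∘ₗ D.condExp) Γ := by
      rw [pairing_comp_left, comp_condExp_of_mem hΓ, pairing_comp, condExp_comp_of_mem hΓ]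
    rw [heq]
    set p := B.condExp ∘ₗ φ ∘ₗ D.condExp
    obtain ⟨β', hβ'⟩ := channels_nonempty hP D A'
    obtain ⟨μ, hμ⟩ := channels_nonempty hP D B
    by_contra! hneg
    set c := pairing (Ψ ∘ₗ β') Γ + ε * pairing μ Γ with hc
    have hscale : ∀ s : ℝ, 0 ≤ s → -(s * pairing p Γ) + c < u := fun s hs => by
      have := hKle (s • p) (algCone_smul hP hs hφ') β' hβ' μ hμ
      rwa [pairing_smul] at this
    have h0 := hscale 0 le_rfl
    -- At this scale the left side equals `u`, against the strict inequality.
    have hs := hscale ((u - c) / -pairing p Γ) (div_nonneg (by linarith) (by linarith))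
    have : -((u - c) / -pairing p Γ * pairing p Γ) = u - c := by
      rw [← mul_neg, div_mul_cancel₀ _ (by linarith)]
    linarith
  obtain ⟨β', hβ', hle⟩ := h Γ hΓdual β hβ
  obtain ⟨μ, hμ, hmax⟩ := dualDiamondNorm_eq_pairing_channel hP hΓdual.1
  have h1 := hKle 0 (algCone_zero hP) β' hβ' μ hμ
  have h2 : pairing 0 Γ = 0 := (pairingLeft Γ).map_zero
  rw [hmax] at hle
  linarith

theorem diamondNorm_le_of_eq_smul_sub (hP : Admissible P) {φ ψ μ p : SMap D.dim B.dim}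
    (hφ : φ ∈ channels P D B) (hψ : ψ ∈ channels P D B) (hμ : μ ∈ channels P D B)
    (hp : p ∈ algCone P D B) {ε : ℝ} (hε : 0 ≤ ε) (h : φ - ψ = ε • μ - p) :
    diamondNorm P D B (φ - ψ) ≤ 2 * ε := by
  refine le_of_forall_pos_le_add fun δ hδ => ?_
  -- The gauge admits only positive radii, so `δ` covers `ε = 0`. Since `p` scales the trace by `ε`,
  -- the map `ε μ + p + δ μ` scales it by `2ε + δ`.
  have hs : 0 < 2 * ε + δ := by positivity
  have hδμ := algCone_smul hP hδ.le hμ.1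
  have hεμ := algCone_smul hP hε hμ.1
  have hmem : ε • μ + p + δ • μ ∈ algCone P D B := algCone_add hP (algCone_add hP hεμ hp) hδμ
  have hpe : p = ε • μ - (φ - ψ) := by rw [h]; abel
  refine diamondNorm_le hs (inv_smul_mem_channels hP hmem hs fun a => ?_) ?_ ?_
  · rw [hpe]
    simp only [LinearMap.add_apply, LinearMap.sub_apply, LinearMap.smul_apply, Matrix.trace_add,
      Matrix.trace_sub, Matrix.trace_smul, hφ.2, hψ.2, hμ.2]
    module
  · rw [smul_smul, mul_inv_cancel₀ hs.ne', one_smul, h]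
    convert algCone_add hP (algCone_smul hP zero_le_two hp) hδμ using 1
    module
  · rw [smul_smul, mul_inv_cancel₀ hs.ne', one_smul, h]
    convert algCone_add hP (algCone_smul hP zero_le_two hεμ) hδμ using 1
    module

theorem exists_diamondNorm_le_of_preDeficientFor (hP : Admissible P) {Φ : SMap A.dim B.dim}
    (hΦ : Φ ∈ channels P A B) {Ψ : SMap A'.dim B.dim} (hΨ : Ψ ∈ channels P A' B) {ε : ℝ}
    (hε : 0 ≤ ε) (h : PreDeficientFor (A := A) (A' := A') (B := B) P ε D Ψ Φ) :
    ∀ β ∈ channels P D A, ∃ β' ∈ channels P D A',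
      diamondNorm P D B (Φ ∘ₗ β - Ψ ∘ₗ β') ≤ 2 * ε := by
  intro β hβ
  obtain ⟨β', hβ', μ, hμ, p, hp, heq⟩ := exists_eq_sub_of_preDeficientFor hP hΦ hΨ h hβ
  exact ⟨β', hβ', diamondNorm_le_of_eq_smul_sub hP (channels_comp hP hΦ hβ)
    (channels_comp hP hΨ hβ') hμ hp hε heq⟩

theorem preDeficientFor_of_diamondNorm_le (hP : Admissible P) {Φ : SMap A.dim B.dim}
    (hΦ : Φ ∈ channels P A B) {Ψ : SMap A'.dim B.dim} (hΨ : Ψ ∈ channels P A' B) {ε : ℝ}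
    (h : ∀ β ∈ channels P D A, ∃ β' ∈ channels P D A',
      diamondNorm P D B (Φ ∘ₗ β - Ψ ∘ₗ β') ≤ 2 * ε) :
    PreDeficientFor (A := A) (A' := A') (B := B) P ε D Ψ Φ := by
  intro Γ hΓ β hβ
  obtain ⟨β', hβ', hn⟩ := h β hβ
  exact ⟨β', hβ', pairing_sub_channels_le hP hΓ.1 (channels_comp hP hΦ hβ)
    (channels_comp hP hΨ hβ') hn⟩

/-- The maps `ξ` with `-r α ≤ ξ ≤ r α` for some channel `α`. -/
def sectionBall (P : ConeFamily) (A B : Alg) (r : ℝ) : Set (SMap A.dim B.dim) :=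
  {ξ | ∃ α ∈ channels P A B, r • α - ξ ∈ algCone P A B ∧ r • α + ξ ∈ algCone P A B}

theorem sectionBall_subset_algMaps (r : ℝ) : sectionBall P A B r ⊆ algMaps A B := by
  rintro ξ ⟨α, hα, h, -⟩
  have := algMaps_sub (algMaps_smul r hα.1.2) h.2
  rwa [sub_sub_cancel] at this

theorem sectionBall_convex (hP : Admissible P) (r : ℝ) : Convex ℝ (sectionBall P A B r) := by
  rintro ξ ⟨α, hα, h₁, h₂⟩ η ⟨μ, hμ, h₃, h₄⟩ s t hs ht hst
  refine ⟨s • α + t • μ, channels_convex hP hα hμ hs ht hst, ?_, ?_⟩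
  · convert algCone_add hP (algCone_smul hP hs h₁) (algCone_smul hP ht h₃) using 1
    module
  · convert algCone_add hP (algCone_smul hP hs h₂) (algCone_smul hP ht h₄) using 1
    module

/-- The ball is the projection of a compact set of pairs `(α, ξ)`: channels are compact, the order
constraints are closed, and they bound `ξ`. -/
theorem sectionBall_isCompact (hP : Admissible P) (A B : Alg) (r : ℝ) :
    IsCompact (sectionBall P A B r) := by
  have : ProperSpace (SMap A.dim B.dim) := FiniteDimensional.proper ℝ _
  obtain ⟨C, -, hle⟩ := norm_le_of_channel_dominating hP A B
  have hcl := algCone_isClosed hP A B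
  have hR : IsCompact ((channels P A B ×ˢ Metric.closedBall (0 : SMap A.dim B.dim) (C * r)) ∩
      {x | r • x.1 - x.2 ∈ algCone P A B ∧ r • x.1 + x.2 ∈ algCone P A B}) := by
    refine ((channels_isCompact hP A B).prod (isCompact_closedBall _ _)).inter_right ?_
    exact (hcl.preimage (f := fun x : SMap A.dim B.dim × SMap A.dim B.dim => r • x.1 - x.2)
      (by fun_prop)).inter
      (hcl.preimage (f := fun x : SMap A.dim B.dim × SMap A.dim B.dim => r • x.1 + x.2)
        (by fun_prop))
  convert hR.image continuous_snd using 1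
  ext ξ
  constructor
  · rintro ⟨α, hα, h₁, h₂⟩
    exact ⟨(α, ξ), ⟨⟨hα, mem_closedBall_zero_iff.2 (hle _ _ _ hα h₁ h₂)⟩, h₁, h₂⟩, rfl⟩
  · rintro ⟨⟨α, ξ⟩, ⟨⟨hα, -⟩, h₁, h₂⟩, rfl⟩
    exact ⟨α, hα, h₁, h₂⟩

theorem smul_mem_sectionBall (hP : Admissible P) {ξ : SMap A.dim B.dim} (hξ : ξ ∈ algMaps A B)
    {r s : ℝ} (hr : 0 ≤ r) (hn : diamondNorm P A B ξ < s) : (r / s) • ξ ∈ sectionBall P A B r := by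
  obtain ⟨hs, α, hα, h₁, h₂⟩ := exists_channel_of_diamondNorm_lt hP hξ hn
  have hrs : 0 ≤ r / s := by positivity
  refine ⟨α, hα, ?_, ?_⟩
  · convert algCone_smul hP hrs h₁ using 1
    rw [smul_sub, smul_smul, div_mul_cancel₀ _ hs.ne']
  · convert algCone_smul hP hrs h₂ using 1
    rw [smul_add, smul_smul, div_mul_cancel₀ _ hs.ne']

theorem diamondNorm_le_of_mem_sectionBall (hP : Admissible P) {ξ : SMap A.dim B.dim} {r : ℝ}
    (hr : 0 ≤ r) (hξ : ξ ∈ sectionBall P A B r) : diamondNorm P A B ξ ≤ r := by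
  obtain ⟨α, hα, h₁, h₂⟩ := hξ
  refine le_of_forall_pos_le_add fun δ hδ => ?_
  have h := algCone_smul hP hδ.le hα.1
  refine diamondNorm_le (by positivity) hα ?_ ?_
  · convert algCone_add hP h₁ h using 1
    module
  · convert algCone_add hP h₂ h using 1
    module

theorem mul_dualDiamondNorm_le (hP : Admissible P) {Γ : SMap B.dim D.dim} {r c : ℝ} (hr : 0 ≤ r)
    (h : ∀ ξ ∈ sectionBall P D B r, pairing ξ Γ ≤ c) : r * dualDiamondNorm P B D Γ ≤ c := by
  have key : ∀ ξ ∈ algMaps D B, diamondNorm P D B ξ ≤ 1 → r * pairing ξ Γ ≤ c := by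
    intro ξ hξ hn
    rw [← one_mul c]
    refine le_mul_of_forall_pos fun δ hδ => ?_
    have := h _ (smul_mem_sectionBall hP hξ hr (hn.trans_lt (lt_add_of_pos_right 1 hδ)))
    rw [pairing_smul, div_mul_eq_mul_div, div_le_iff₀ (by positivity)] at this
    linarith
  -- For `r = 0` division is impossible, but the ball contains `0`, which gives `0 ≤ c`.
  rcases hr.eq_or_lt with rfl | hr'
  · have := h 0 (by
      obtain ⟨α, hα⟩ := channels_nonempty hP D B
      exact ⟨α, hα, by simpa using algCone_zero hP, by simpa using algCone_zero hP⟩)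
    have h2 : pairing 0 Γ = 0 := (pairingLeft Γ).map_zero
    rw [h2] at this
    simpa using this
  · rw [mul_comm, ← le_div_iff₀ hr']
    refine dualDiamondNorm_le hP fun ξ hξ hn => ?_
    rw [le_div_iff₀ hr', mul_comm]
    exact key ξ hξ hn

theorem exists_pairing_le_of_diamondNorm_le (hP : Admissible P) {Φ : SMap A.dim B.dim}
    (hΦ : Φ ∈ channels P A B) {Ψ : SMap A'.dim B.dim} (hΨ : Ψ ∈ channels P A' B) {r : ℝ}
    (h : ∀ β ∈ channels P D A, ∃ β' ∈ channels P D A',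
      diamondNorm P D B (Φ ∘ₗ β - Ψ ∘ₗ β') ≤ r) (Γ : SMap B.dim D.dim) :
    ∀ β ∈ channels P D A, ∃ β' ∈ channels P D A',
      pairing (Φ ∘ₗ β) Γ ≤ pairing (Ψ ∘ₗ β') Γ + r * dualDiamondNorm P B D Γ := by
  intro β hβ
  obtain ⟨β', hβ', hn⟩ := h β hβ
  have := pairing_le_diamondNorm_mul hP Γ
    (algMaps_sub (channels_comp hP hΦ hβ).1.2 (channels_comp hP hΨ hβ').1.2) hn
  rw [pairing_sub] at this
  exact ⟨β', hβ', by linarith⟩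

open scoped Pointwise in
-- If no `β'` worked, `Φ ∘ β` would lie outside the compact convex set `Ψ ∘ 𝒞(𝒟, 𝒜')` plus the ball
-- of radius `r`. The supremum of a separating `Γ` over that ball is at least `r ‖Γ‖^⋄`, which
-- contradicts `h` at `Γ`.
theorem exists_diamondNorm_le_of_pairing_le (hP : Admissible P) {Φ : SMap A.dim B.dim}
    (hΦ : Φ ∈ channels P A B) {Ψ : SMap A'.dim B.dim} (hΨ : Ψ ∈ channels P A' B) {r : ℝ}
    (hr : 0 ≤ r) {β : SMap D.dim A.dim} (hβ : β ∈ channels P D A)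
    (h : ∀ Γ ∈ algMaps B D, ∃ β' ∈ channels P D A',
      pairing (Φ ∘ₗ β) Γ ≤ pairing (Ψ ∘ₗ β') Γ + r * dualDiamondNorm P B D Γ) :
    ∃ β' ∈ channels P D A', diamondNorm P D B (Φ ∘ₗ β - Ψ ∘ₗ β') ≤ r := by
  by_cases hx : Φ ∘ₗ β ∈ postcomp Ψ '' channels P D A' + sectionBall P D B r
  · obtain ⟨_, ⟨β', hβ', rfl⟩, ξ, hξ, hxe⟩ := hx
    refine ⟨β', hβ', diamondNorm_le_of_mem_sectionBall hP hr ?_⟩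
    rwa [← hxe, show postcomp Ψ β' = Ψ ∘ₗ β' from rfl, add_sub_cancel_left]
  exfalso
  obtain ⟨Γ, hΓ, u, hu, hux⟩ := exists_pairing_separating
    ((postcomp_image_convex hP D Ψ).add (sectionBall_convex hP r))
    ((postcomp_image_isCompact hP D Ψ).add (sectionBall_isCompact hP D B r)).isClosed
    (by
      rintro _ ⟨_, ⟨β', hβ', rfl⟩, ξ, hξ, rfl⟩
      exact algMaps_add (channels_comp hP hΨ hβ').1.2 (sectionBall_subset_algMaps r hξ))
    (channels_comp hP hΦ hβ).1.2 hx
  obtain ⟨β', hβ', hle⟩ := h Γ hΓ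
  have : r * dualDiamondNorm P B D Γ ≤ u - pairing (Ψ ∘ₗ β') Γ := by
    refine mul_dualDiamondNorm_le hP hr fun ξ hξ => ?_
    have := hu _ (Set.add_mem_add ⟨β', hβ', rfl⟩ hξ)
    rw [pairing_add, show postcomp Ψ β' = Ψ ∘ₗ β' from rfl] at this
    linarith
  linarith

/-- If `s α` dominates `±ξ`, then `s (α ∘ β)` dominates `±(ξ ∘ β)`. -/
theorem diamondNorm_comp_channel_le (hP : Admissible P) {ξ : SMap A.dim B.dim}
    (hξ : ξ ∈ algMaps A B) {β : SMap D.dim A.dim} (hβ : β ∈ channels P D A) :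
    diamondNorm P D B (ξ ∘ₗ β) ≤ diamondNorm P A B ξ := by
  refine le_of_forall_gt_imp_ge_of_dense fun s hs => ?_
  obtain ⟨hs0, α, hα, h₁, h₂⟩ := exists_channel_of_diamondNorm_lt hP hξ hs
  exact diamondNorm_le hs0 (channels_comp hP hα hβ) (algCone_comp hP h₁ hβ.1)
    (algCone_comp hP h₂ hβ.1)

theorem preDeficient_of_preDeficientFor_self (hP : Admissible P) {Φ : SMap A.dim B.dim}
    (hΦ : Φ ∈ channels P A B) {Ψ : SMap A'.dim B.dim} (hΨ : Ψ ∈ channels P A' B) {ε : ℝ}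
    (hε : 0 ≤ ε) (hid : A.condExp ∈ algCone P A A)
    (h : PreDeficientFor (A := A) (A' := A') (B := B) P ε A Ψ Φ) :
    PreDeficient (A := A) (A' := A') (B := B) P ε Ψ Φ := by
  intro D
  obtain ⟨γ, hγ, hn⟩ := exists_diamondNorm_le_of_preDeficientFor hP hΦ hΨ hε h A.condExp
    ⟨hid, A.trace_condExp⟩
  rw [comp_condExp_of_mem hΦ.1.2] at hn
  refine preDeficientFor_of_diamondNorm_le hP hΦ hΨ fun β hβ =>
    ⟨γ ∘ₗ β, channels_comp hP hγ hβ, ?_⟩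
  rw [← LinearMap.comp_assoc, ← LinearMap.sub_comp]
  exact (diamondNorm_comp_channel_le hP
    (algMaps_sub hΦ.1.2 (channels_comp hP hΨ hγ).1.2) hβ).trans hn

end Deficiency

end ChannelComparison

open ChannelComparison in
theorem mainTheorem2 (P : ConeFamily) (hP : Admissible P) (A A' B : Alg)
    (Φ : SMap A.dim B.dim) (hΦ : Φ ∈ channels P A B)
    (Ψ : SMap A'.dim B.dim) (hΨ : Ψ ∈ channels P A' B)
    (ε : ℝ) (hε : 0 ≤ ε) :
    (∀ D : Alg, List.TFAE
      [ PreDeficientFor (A := A) (A' := A') (B := B) P ε D Ψ Φ,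
        ∀ Γ ∈ algDualCone P B D,
          dualDiamondNorm P A D (Γ ∘ₗ Φ) ≤
            dualDiamondNorm P A' D (Γ ∘ₗ Ψ) + ε * dualDiamondNorm P B D Γ,
        ∀ Γ ∈ algMaps B D, ∀ β ∈ channels P D A, ∃ β' ∈ channels P D A',
          pairing (Φ ∘ₗ β) Γ ≤ pairing (Ψ ∘ₗ β') Γ + 2 * ε * dualDiamondNorm P B D Γ,
        ∀ β ∈ channels P D A, ∃ β' ∈ channels P D A',
          diamondNorm P D B (Φ ∘ₗ β - Ψ ∘ₗ β') ≤ 2 * ε ]) ∧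
    (A.condExp ∈ algCone P A A →
      (PreDeficient (A := A) (A' := A') (B := B) P ε Ψ Φ ↔
        PreDeficientFor (A := A) (A' := A') (B := B) P ε A Ψ Φ)) := by
  refine ⟨fun D => ?_, fun hid =>
    ⟨fun h => h A, preDeficient_of_preDeficientFor_self hP hΦ hΨ hε hid⟩⟩
  tfae_have 1 ↔ 2 := preDeficientFor_iff_dualDiamondNorm_le hP hΦ hΨ ε
  tfae_have 1 → 4 := exists_diamondNorm_le_of_preDeficientFor hP hΦ hΨ hε
  tfae_have 4 → 1 := preDeficientFor_of_diamondNorm_le hP hΦ hΨ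
  tfae_have 4 → 3 := fun h Γ _ => exists_pairing_le_of_diamondNorm_le hP hΦ hΨ h Γ
  tfae_have 3 → 4 := fun h β hβ =>
    exists_diamondNorm_le_of_pairing_le hP hΦ hΨ (by positivity) hβ fun Γ hΓ => h Γ hΓ β hβ
  tfae_finish
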